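/- A space $Y$ is an ANR if it is metrizable and every continuous map $f\colon A\to Y$ from a closed subset $A$ of a metrizable space $Z$ extends continuously to an open neighborhood of $A$ in $Z$. Let $r\in\mathbb{N}$ with $r\geq 2$, let $E$ and $X$ be ANRs and let $p\colon E\to X$ be a (Hurewicz) fibration with path-connected fibers. Put $$E^r_X=\{(u_1,\dots,u_r)\in E^r\mid p(u_1)=\dots=p(u_r)\},\qquad q_r\colon E^r_X\to X,\quad q_r(u_1,\dots,u_r)=p(u_1),$$ let $E^I_X$ be the space of continuous paths $\gamma\colon[0,1]\to E$ for which $p\circ\gamma$ is constant, with the compact-open topology, and let $$\Pi_r\colon E^I_X\to E^r_X,\qquad \Pi_r(\gamma)=\big(\gamma(0),\gamma(\tfrac{1}{r-1}),\dots,\gamma(\tfrac{r-2}{r-1}),\gamma(1)\big).$$ For $A\subset E^r_X$ let $\mathrm{TC}_{r,p}(A)\in\{0,1,2,\dots\}\cup\{\infty\}$ be the smallest $n$ for which there exist open subsets $U_1,\dots,U_n\subset E^r_X$ with $A\subset\bigcup_{i=1}^n U_i$ such that for each $i$ there is a continuous map $s_i\colon U_i\to E^I_X$ with $\Pi_r(s_i(u))=u$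 for all $u\in U_i$; if there is no such $n$, put $\mathrm{TC}_{r,p}(A)=\infty$. Let $\Phi\colon E^r_X\times[0,1]\to E^r_X$ be continuous with $$\Phi(u,0)=u,\qquad q_r(\Phi(u,t))=q_r(u)\qquad\forall u\in E^r_X,\ t\in[0,1],$$ put $\Phi_1:=\Phi(\cdot,1)$ and $\mathrm{Fix}\,\Phi_1=\{u\in E^r_X\mid\Phi_1(u)=u\}$. Let $F\colon E^r_X\to\mathbb{R}$ be continuous and bounded from below with $F(\Phi_1(u))\leq F(u)$ for all $u\in E^r_X$ (that is, $F$ is a Lyapunov function for $\Phi_1$), and suppose that $(\Phi_1,F)$ satisfies condition (D): * $(D_1)$ $F(\Phi_1(u))<F(u)$ for all $u\in E^r_X\setminus\mathrm{Fix}\,\Phi_1$; * $(D_2)$ if $A\subset E^r_X$ is nonempty, $F$ is bounded on $A$ and $\inf\{F(a)-F(\Phi_1(a))\mid a\in A\}=0$, then $\overline{A}\cap\mathrm{Fix}\,\Phi_1\neq\emptyset$. For $\lambda,\mu\in\mathbb{R}$ put $F^\lambda=\{u\in E^r_X\mid F(u)\leq\lambda\}$ and $F_\mu=\{u\in E^r_X\mid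 F(u)=\mu\}$. Then $$\mathrm{TC}_{r,p}(F^\lambda)\leq\sum_{\mu\in(-\infty,\lambda]}\mathrm{TC}_{r,p}(F_\mu\cap\mathrm{Fix}\,\Phi_1)\qquad\forall\lambda\in\mathbb{R},$$ where the sum is taken in $\{0,1,2,\dots\}\cup\{\infty\}$. -/

import Mathlib

open scoped unitInterval

universe u v

namespace ParamTC

/-- A topological space `Y` is an *absolute neighborhood retract* (ANR) if it is metrizable and every
continuous map from a closed subset `A` of a metrizable space `Z` to `Y` extends continuously to an
open neighborhood of `A` in `Z`. (By Dugundji's theorem it makes no difference in which universe the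
test spaces `Z` live, as long as it is at least the universe of `Y`.) -/
def IsANR (Y : Type u) [TopologicalSpace Y] : Prop :=
  TopologicalSpace.MetrizableSpace Y ∧
    ∀ (Z : Type u) [TopologicalSpace Z] [TopologicalSpace.MetrizableSpace Z] (A : Set Z),
      IsClosed A → ∀ f : A → Y, Continuous f →
        ∃ (V : Set Z) (hAV : A ⊆ V) (G : V → Y),
          IsOpen V ∧ Continuous G ∧ ∀ a : A, G ⟨a, hAV a.2⟩ = f a

/-- A *fibration* (in the sense of Hurewicz): a continuous map with the homotopy lifting property
with respect to all topological spaces. (Lifting for the mapping path space of `p`, which lives in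
`Type (max u v)`, implies lifting for spaces in every universe.) -/
def IsFibration {E : Type u} {X : Type v} [TopologicalSpace E] [TopologicalSpace X]
    (p : E → X) : Prop :=
  Continuous p ∧
    ∀ (Y : Type (max u v)) [TopologicalSpace Y] (H : Y × I → X) (f : Y → E),
      Continuous H → Continuous f → (∀ y, H (y, 0) = p (f y)) →
        ∃ G : Y × I → E, Continuous G ∧ (∀ y, G (y, 0) = f y) ∧ ∀ z, p (G z) = H z

section Fiberwise

variable {E : Type u} {X : Type v} [TopologicalSpace E] [TopologicalSpace X]

/-- `E^r_X`: the `r`-tuples of points of `E` lying in a common fiber of `p`, with the subspace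
topology of `E^r`. -/
abbrev FiberPower (p : E → X) (r : ℕ) : Type u :=
  {w : Fin r → E // ∀ i j, p (w i) = p (w j)}

/-- `E^I_X`: the continuous paths in `E` lying in a single fiber of `p`, with the subspace topology
of the path space `C(I, E)` (compact-open topology). -/
abbrev FiberPath (p : E → X) : Type u :=
  {γ : C(I, E) // ∀ t, p (γ t) = p (γ 0)}

/-- The projection `q_r : E^r_X → X`, `q_r(u_1, …, u_r) = p(u_1)`. -/
def fiberProj (p : E → X) {r : ℕ} (hr : 2 ≤ r) (w : FiberPower p r) : X :=
  p (w.1 ⟨0, by omega⟩)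

/-- The time `i / (r - 1)` in `[0,1]`, for `i = 0, 1, …, r - 1`. -/
noncomputable def stage {r : ℕ} (hr : 2 ≤ r) (i : Fin r) : I :=
  ⟨(i : ℝ) / ((r : ℝ) - 1), by
    have h2 : (2 : ℝ) ≤ r := by exact_mod_cast hr
    have hi : (i : ℝ) + 1 ≤ r := by exact_mod_cast i.2
    have h0 : (0 : ℝ) ≤ (i : ℝ) := Nat.cast_nonneg _
    exact ⟨div_nonneg h0 (by linarith), (div_le_one (by linarith)).2 (by linarith)⟩⟩

/-- The map `Π_r : E^I_X → E^r_X`, `Π_r(γ) = (γ(0), γ(1/(r-1)), …, γ((r-2)/(r-1)), γ(1))`. -/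
noncomputable def evalStages (p : E → X) {r : ℕ} (hr : 2 ≤ r) (γ : FiberPath p) :
    FiberPower p r :=
  ⟨fun i => γ.1 (stage hr i), fun _ _ => (γ.2 _).trans (γ.2 _).symm⟩

/-- `A ⊆ E^r_X` admits a continuous sequential parametrized motion planner, i.e. a continuous local
section `A → E^I_X` of `Π_r`. -/
def HasMotionPlanner (p : E → X) {r : ℕ} (hr : 2 ≤ r) (A : Set (FiberPower p r)) : Prop :=
  ∃ s : A → FiberPath p, Continuous s ∧ ∀ a : A, evalStages p hr (s a) = a

/-- The `r`-th sequential parametrized subspace complexity `TC_{r,p}(A) ∈ {0, 1, 2, …, ∞}` of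
`A ⊆ E^r_X`: the least number `n` of open subsets of `E^r_X` that cover `A` and each admit a
continuous sequential parametrized motion planner, and `∞` if there is no such `n`. -/
noncomputable def subspaceTC (p : E → X) {r : ℕ} (hr : 2 ≤ r) (A : Set (FiberPower p r)) : ℕ∞ :=
  sInf {m : ℕ∞ | ∃ n : ℕ, m = n ∧ ∃ U : Fin n → Set (FiberPower p r),
    (∀ i, IsOpen (U i)) ∧ A ⊆ ⋃ i, U i ∧ ∀ i, HasMotionPlanner p hr (U i)}

end Fiberwise

section Lyapunov

variable {Y : Type u} [TopologicalSpace Y]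

/-- `f` is a *Lyapunov function* for `φ`: it is continuous and does not increase along `φ`. -/
def IsLyapunov (φ : Y → Y) (f : Y → ℝ) : Prop :=
  Continuous f ∧ ∀ x, f (φ x) ≤ f x

/-- Condition (D) for a self-map `φ` and a Lyapunov function `f` for it. In the second part,
`IsGLB` expresses that the infimum of `f(a) - f(φ(a))` over `a ∈ A` is `0`; in particular `A` is
then nonempty. -/
structure ConditionD (φ : Y → Y) (f : Y → ℝ) : Prop where
  strict : ∀ x, x ∉ Function.fixedPoints φ → f (φ x) < f x
  closure_meets : ∀ A : Set Y, Bornology.IsBounded (f '' A) →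
    IsGLB ((fun a => f a - f (φ a)) '' A) 0 →
      (closure A ∩ Function.fixedPoints φ).Nonempty

end Lyapunov

end ParamTC

/-! `subspaceTC` is an index ν of Lusternik–Schnirelmann type: zero on ∅, monotone, subadditive, not
increased by passing to a suitable open neighborhood, and ν(A) ≤ ν(Φ₁(A)). Only the last needs
geometry: `HasMotionPlanner.preimage` inserts, at each stage of a path through the components of
Φ₁(w), a round trip along Φ back to w.

For any such index, `ConditionD.index_sublevel_le_sum` strips off the highest fixed level c. By
condition (D), φ lowers F uniformly away from fixed points, so iterates push the sublevel set to
slightly above c at most; off a neighborhood U of the fixed points at c, one more application lands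
below c. Hence ν(F^λ) ≤ ν(F^(c-ε)) + ν(U), and induction on the finite set of levels concludes. With
infinitely many fixed levels the sum is infinite. -/

namespace ParamTC

/-! ### Transport of motion planners along fiberwise homotopies -/

section MotionPlanners

variable {E : Type u} {X : Type v} [TopologicalSpace E]

/-- A continuous nondecreasing function which takes the value `i` on `[i - 1/3, i + 1/3]` for
`i = 0, …, n`. -/
noncomputable def stairs (n : ℕ) (x : ℝ) : ℝ :=
  ∑ j ∈ Finset.range n, max 0 (min 1 (3 * (x - j) - 1))

theorem continuous_stairs (n : ℕ) : Continuous (stairs n) := by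
  unfold stairs
  fun_prop

theorem stairs_eq {n i : ℕ} (hi : i ≤ n) {x : ℝ} (hx : |x - i| ≤ 1 / 3) : stairs n x = i := by
  obtain ⟨h1, h2⟩ := abs_le.1 hx
  have key : ∀ j ∈ Finset.range n,
      max 0 (min 1 (3 * (x - j) - 1)) = if j < i then (1 : ℝ) else 0 := by
    intro j _
    split_ifs with hj
    · have : (j : ℝ) + 1 ≤ i := by exact_mod_cast hj
      rw [min_eq_left (by linarith), max_eq_right zero_le_one]
    · have : (i : ℝ) ≤ j := by exact_mod_cast not_lt.1 hj
      exact max_eq_left ((min_le_right _ _).trans (by linarith))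
  rw [stairs, Finset.sum_congr rfl key, Finset.sum_ite, Finset.sum_const, Finset.sum_const_zero]
  have : (Finset.range n).filter (· < i) = Finset.range i := by
    ext j
    simp only [Finset.mem_filter, Finset.mem_range]
    omega
  simp [this]

/-- Motion planners pull back along the end map of a fiberwise homotopy `Φ` starting at the
identity: near the `i`-th stage the new path runs along the `i`-th component of `Φ` and back. -/
theorem HasMotionPlanner.preimage {p : E → X} {r : ℕ} {hr : 2 ≤ r}
    {Φ : FiberPower p r × I → FiberPower p r} (hΦ : Continuous Φ)
    (hΦ_zero : ∀ w, Φ (w, 0) = w)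
    (hΦ_fiber : ∀ w t, fiberProj p hr (Φ (w, t)) = fiberProj p hr w)
    {U : Set (FiberPower p r)} (hU : HasMotionPlanner p hr U) :
    HasMotionPlanner p hr ((fun w => Φ (w, 1)) ⁻¹' U) := by
  classical
  obtain ⟨s, hs, hsU⟩ := hU
  set V : Set (FiberPower p r) := (fun w => Φ (w, 1)) ⁻¹' U
  have hr1 : (0 : ℝ) < (r : ℝ) - 1 := by
    have : (2 : ℝ) ≤ r := by exact_mod_cast hr
    linarith
  let x : V × I → ℝ := fun z => ((r : ℝ) - 1) * (z.2 : ℝ)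
  have hx : Continuous x := by fun_prop
  -- The detour: in rescaled time it is at `w i` exactly at stage `i`, and at the `i`-th component
  -- of Φ₁(w) at distance 1/3.
  let c : Fin r → V × I → E := fun i z =>
    (Φ (z.1.1, Set.projIcc 0 1 zero_le_one (3 * |x z - i|))).1 i
  have hc : ∀ i, Continuous (c i) := fun i => by
    have h1 : Continuous fun z : V × I => Set.projIcc (0 : ℝ) 1 zero_le_one (3 * |x z - i|) :=
      continuous_projIcc.comp (by fun_prop)
    have h2 : Continuous fun z : V × I =>
        Φ (z.1.1, Set.projIcc (0 : ℝ) 1 zero_le_one (3 * |x z - i|)) :=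
      hΦ.comp ((continuous_subtype_val.comp continuous_fst).prodMk h1)
    exact (continuous_apply i).comp (continuous_subtype_val.comp h2)
  -- The clock of the given planner stands still at stage `i` during the `i`-th detour.
  let time : V × I → I := fun z =>
    Set.projIcc 0 1 zero_le_one (stairs (r - 1) (x z) / ((r : ℝ) - 1))
  have htime : Continuous time :=
    continuous_projIcc.comp (((continuous_stairs _).comp hx).div_const _)
  let m : V × I → E := fun z => (s ⟨Φ (z.1.1, 1), z.1.2⟩).1 (time z)
  have hm : Continuous m := by
    have h1 : Continuous fun z : V × I => (⟨Φ (z.1.1, 1), z.1.2⟩ : U) :=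
      Continuous.subtype_mk
        (hΦ.comp ((continuous_subtype_val.comp continuous_fst).prodMk continuous_const)) _
    exact ContinuousEval.continuous_eval.comp
      ((continuous_subtype_val.comp (hs.comp h1)).prodMk htime)
  let W : Fin r → Set (V × I) := fun i => {z | |x z - i| ≤ 1 / 3}
  let M : Set (V × I) := {z | ∀ i : Fin r, 1 / 3 ≤ |x z - i|}
  have hWW : ∀ {i j : Fin r} {z}, z ∈ W i → z ∈ W j → i = j := by
    intro i j z hi hj
    obtain ⟨a1, a2⟩ := abs_le.1 (show |x z - i| ≤ 1 / 3 from hi)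
    obtain ⟨b1, b2⟩ := abs_le.1 (show |x z - j| ≤ 1 / 3 from hj)
    have h1 : (i : ℝ) < (j : ℝ) + 1 := by linarith
    have h2 : (j : ℝ) < (i : ℝ) + 1 := by linarith
    have h1' : (i : ℕ) < (j : ℕ) + 1 := by exact_mod_cast h1
    have h2' : (j : ℕ) < (i : ℕ) + 1 := by exact_mod_cast h2
    exact Fin.ext (by omega)
  let g : V × I → E := fun z => if h : ∃ i, z ∈ W i then c h.choose z else m z
  have hgW : ∀ i, ∀ z ∈ W i, g z = c i z := by
    intro i z hz
    have h : ∃ i, z ∈ W i := ⟨i, hz⟩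
    simp only [g, dif_pos h]
    rw [hWW h.choose_spec hz]
  have hgM : ∀ z ∈ M, g z = m z := by
    intro z hz
    by_cases h : ∃ i, z ∈ W i
    · obtain ⟨i, hi⟩ := h
      rw [hgW i z hi]
      have habs : |x z - i| = 1 / 3 := le_antisymm hi (hz i)
      have hst : time z = stage hr i := by
        have : stairs (r - 1) (x z) = (i : ℕ) := stairs_eq (by omega) hi
        simp only [time, this]
        exact Set.projIcc_of_mem zero_le_one (stage hr i).2
      have hone : Set.projIcc (0 : ℝ) 1 zero_le_one (3 * |x z - i|) = 1 :=
        Set.projIcc_of_right_le _ (by rw [habs]; norm_num)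
      simp only [c, m, hone, hst]
      exact (congrArg (fun w : FiberPower p r => w.1 i) (hsU ⟨Φ (z.1.1, 1), z.1.2⟩)).symm
    · simp only [g, dif_neg h]
  have hg : Continuous g := by
    -- Pasting over finitely many closed sets: `M` meets `W i` only where the distance to `i` is
    -- 1/3, and there `c i` and `m` agree.
    let C : Option (Fin r) → Set (V × I) := fun o => o.elim M W
    refine (locallyFinite_of_finite C).continuous (g := g) ?_ ?_ ?_
    · refine Set.eq_univ_of_forall fun z => Set.mem_iUnion.2 ?_
      by_cases h : ∃ i, z ∈ W i
      · obtain ⟨i, hi⟩ := h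
        exact ⟨some i, hi⟩
      · push Not at h
        exact ⟨none, fun i => (not_le.1 (h i)).le⟩
    · rintro (_ | i)
      · change IsClosed M
        simp only [M, Set.ofPred_forall]
        exact isClosed_iInter fun i => isClosed_le continuous_const (by fun_prop)
      · exact isClosed_le (by fun_prop) continuous_const
    · rintro (_ | i)
      · exact hm.continuousOn.congr hgM
      · exact (hc i).continuousOn.congr (hgW i)
  have hpc : ∀ i z, p (c i z) = fiberProj p hr z.1.1 := fun i z =>
    ((Φ (z.1.1, _)).2 i ⟨0, by omega⟩).trans (hΦ_fiber _ _)
  have hpm : ∀ z, p (m z) = fiberProj p hr z.1.1 := by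
    intro z
    have h1 := (s ⟨Φ (z.1.1, 1), z.1.2⟩).2
    have h2 := congrArg (fiberProj p hr) (hsU ⟨Φ (z.1.1, 1), z.1.2⟩)
    exact ((h1 _).trans (h1 _).symm).trans (h2.trans (hΦ_fiber _ _))
  have hpg : ∀ z, p (g z) = fiberProj p hr z.1.1 := by
    intro z
    by_cases h : ∃ i, z ∈ W i
    · simp only [g, dif_pos h, hpc]
    · simp only [g, dif_neg h, hpm]
  let G : C(V, C(I, E)) := ContinuousMap.curry ⟨g, hg⟩
  refine ⟨fun w => ⟨G w, fun t => (hpg (w, t)).trans (hpg (w, 0)).symm⟩,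
    G.continuous.subtype_mk _, fun w => Subtype.ext (funext fun i => ?_)⟩
  change g (w, stage hr i) = w.1.1 i
  have hxi : x (w, stage hr i) = i := mul_div_cancel₀ _ hr1.ne'
  have hmem : (w, stage hr i) ∈ W i := by
    change |x (w, stage hr i) - i| ≤ 1 / 3
    rw [hxi]
    norm_num
  have hzero : Set.projIcc (0 : ℝ) 1 zero_le_one (3 * |x (w, stage hr i) - i|) = 0 :=
    Set.projIcc_of_le_left _ (by rw [hxi]; norm_num)
  rw [hgW i _ hmem]
  simp only [c, hzero, hΦ_zero]

end MotionPlanners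

/-! ### The index properties of the subspace complexity -/

section SubspaceTC

variable {E : Type u} {X : Type v} [TopologicalSpace E]
  {p : E → X} {r : ℕ} {hr : 2 ≤ r}

theorem subspaceTC_le_of_cover {A : Set (FiberPower p r)} {n : ℕ}
    (U : Fin n → Set (FiberPower p r)) (hUo : ∀ i, IsOpen (U i)) (hAU : A ⊆ ⋃ i, U i)
    (hU : ∀ i, HasMotionPlanner p hr (U i)) : subspaceTC p hr A ≤ n :=
  sInf_le ⟨n, rfl, U, hUo, hAU, hU⟩

theorem exists_cover_of_subspaceTC_ne_top {A : Set (FiberPower p r)}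
    (hA : subspaceTC p hr A ≠ ⊤) :
    ∃ n : ℕ, subspaceTC p hr A = n ∧ ∃ U : Fin n → Set (FiberPower p r),
      (∀ i, IsOpen (U i)) ∧ A ⊆ ⋃ i, U i ∧ ∀ i, HasMotionPlanner p hr (U i) := by
  have hne : {m : ℕ∞ | ∃ n : ℕ, m = n ∧ ∃ U : Fin n → Set (FiberPower p r),
      (∀ i, IsOpen (U i)) ∧ A ⊆ ⋃ i, U i ∧ ∀ i, HasMotionPlanner p hr (U i)}.Nonempty := by
    by_contra h
    rw [Set.not_nonempty_iff_eq_empty] at h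
    exact hA (by rw [subspaceTC, h, sInf_empty])
  exact csInf_mem hne

theorem subspaceTC_mono {A B : Set (FiberPower p r)} (h : A ⊆ B) :
    subspaceTC p hr A ≤ subspaceTC p hr B := by
  by_cases hB : subspaceTC p hr B = ⊤
  · exact hB ▸ le_top
  obtain ⟨n, hn, U, hUo, hBU, hU⟩ := exists_cover_of_subspaceTC_ne_top hB
  exact hn ▸ subspaceTC_le_of_cover U hUo (h.trans hBU) hU

theorem subspaceTC_empty : subspaceTC p hr ∅ = 0 :=
  le_antisymm (subspaceTC_le_of_cover (n := 0) Fin.elim0 (fun i => i.elim0)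
    (Set.empty_subset _) fun i => i.elim0) zero_le

/-- Lets a sum with finitely many nonzero terms bound the number of fixed levels. -/
theorem one_le_subspaceTC {A : Set (FiberPower p r)} (hA : A.Nonempty) :
    1 ≤ subspaceTC p hr A := by
  rw [Order.one_le_iff_ne_zero]
  intro h0
  obtain ⟨n, hn, U, -, hAU, -⟩ := exists_cover_of_subspaceTC_ne_top (h0 ▸ ENat.zero_ne_top)
  obtain rfl : n = 0 := by exact_mod_cast hn.symm.trans h0
  obtain ⟨a, ha⟩ := hA
  obtain ⟨i, -⟩ := Set.mem_iUnion.1 (hAU ha)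
  exact i.elim0

theorem subspaceTC_union_le (A B : Set (FiberPower p r)) :
    subspaceTC p hr (A ∪ B) ≤ subspaceTC p hr A + subspaceTC p hr B := by
  by_cases hA : subspaceTC p hr A = ⊤
  · simp [hA]
  by_cases hB : subspaceTC p hr B = ⊤
  · simp [hB]
  obtain ⟨n, hn, U, hUo, hAU, hU⟩ := exists_cover_of_subspaceTC_ne_top hA
  obtain ⟨k, hk, V, hVo, hBV, hV⟩ := exists_cover_of_subspaceTC_ne_top hB
  rw [hn, hk, ← Nat.cast_add]
  refine subspaceTC_le_of_cover (Fin.append U V) ?_ ?_ ?_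
  · intro i
    induction i using Fin.addCases <;> simp [hUo, hVo]
  · rintro a (ha | ha)
    · obtain ⟨i, hi⟩ := Set.mem_iUnion.1 (hAU ha)
      exact Set.mem_iUnion.2 ⟨Fin.castAdd k i, by simpa using hi⟩
    · obtain ⟨i, hi⟩ := Set.mem_iUnion.1 (hBV ha)
      exact Set.mem_iUnion.2 ⟨Fin.natAdd n i, by simpa using hi⟩
  · intro i
    induction i using Fin.addCases <;> simp [hU, hV]

theorem exists_isOpen_subspaceTC_le (A : Set (FiberPower p r)) :
    ∃ U, IsOpen U ∧ A ⊆ U ∧ subspaceTC p hr U ≤ subspaceTC p hr A := by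
  by_cases hA : subspaceTC p hr A = ⊤
  · exact ⟨Set.univ, isOpen_univ, Set.subset_univ _, hA ▸ le_top⟩
  obtain ⟨n, hn, U, hUo, hAU, hU⟩ := exists_cover_of_subspaceTC_ne_top hA
  exact ⟨⋃ i, U i, isOpen_iUnion hUo, hAU, hn ▸ subspaceTC_le_of_cover U hUo subset_rfl hU⟩

theorem subspaceTC_le_image {Φ : FiberPower p r × I → FiberPower p r} (hΦ : Continuous Φ)
    (hΦ_zero : ∀ w, Φ (w, 0) = w)
    (hΦ_fiber : ∀ w t, fiberProj p hr (Φ (w, t)) = fiberProj p hr w)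
    (A : Set (FiberPower p r)) :
    subspaceTC p hr A ≤ subspaceTC p hr ((fun w => Φ (w, 1)) '' A) := by
  by_cases hA : subspaceTC p hr ((fun w => Φ (w, 1)) '' A) = ⊤
  · exact hA ▸ le_top
  obtain ⟨n, hn, U, hUo, hAU, hU⟩ := exists_cover_of_subspaceTC_ne_top hA
  rw [hn]
  refine subspaceTC_le_of_cover (fun i => (fun w => Φ (w, 1)) ⁻¹' U i)
    (fun i => (hUo i).preimage (hΦ.comp (.prodMk_left _))) ?_
    fun i => (hU i).preimage hΦ hΦ_zero hΦ_fiber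
  rw [← Set.preimage_iUnion]
  exact Set.image_subset_iff.1 hAU

end SubspaceTC

/-! ### Lusternik–Schnirelmann theory under condition (D) -/

section LusternikSchnirelmann

theorem isBounded_image_of_le {Y : Type*} {f : Y → ℝ} (hbdd : BddBelow (Set.range f)) {A : Set Y} {b : ℝ}
    (hA : ∀ a ∈ A, f a ≤ b) : Bornology.IsBounded (f '' A) :=
  isBounded_iff_bddBelow_bddAbove.2
    ⟨hbdd.mono (Set.image_subset_range _ _), b, Set.forall_mem_image.2 hA⟩

variable {Y : Type u} [TopologicalSpace Y] {φ : Y → Y} {f : Y → ℝ}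

/-- A set without fixed points in its closure, on which `f` is bounded, is moved down by `φ` by a
definite amount. -/
theorem ConditionD.exists_drop (hD : ConditionD φ f) (hf : IsLyapunov φ f) {A : Set Y}
    (hA : Bornology.IsBounded (f '' A)) (hfix : ∀ x ∈ closure A, x ∉ Function.fixedPoints φ) :
    ∃ δ > 0, ∀ a ∈ A, f (φ a) + δ ≤ f a := by
  -- If no δ works, there are arbitrarily small drops, so their infimum is 0 and (D₂) yields a fixed
  -- point in the closure.
  by_contra! h
  have hglb : IsGLB ((fun a => f a - f (φ a)) '' A) 0 := by
    refine ⟨?_, fun b hb => ?_⟩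
    · rintro _ ⟨a, -, rfl⟩
      exact sub_nonneg.2 (hf.2 a)
    · by_contra! hb0
      obtain ⟨a, ha, hlt⟩ := h b hb0
      have : b ≤ f a - f (φ a) := hb ⟨a, ha, rfl⟩
      linarith
  obtain ⟨x, hx, hx'⟩ := hD.closure_meets A hA hglb
  exact hfix x hx hx'

/-- If there are no fixed points at levels in `[a, b]`, finitely many iterations of `φ` push the
sublevel set of `b` into the sublevel set of `a`. -/
theorem ConditionD.exists_iterate_le (hD : ConditionD φ f) (hf : IsLyapunov φ f)
    (hbdd : BddBelow (Set.range f)) {a b : ℝ}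
    (hab : ∀ x ∈ Function.fixedPoints φ, f x ≤ b → f x < a) :
    ∃ n : ℕ, ∀ x, f x ≤ b → f (φ^[n] x) ≤ a := by
  have hclosed : IsClosed {x | a ≤ f x ∧ f x ≤ b} :=
    (isClosed_le continuous_const hf.1).inter (isClosed_le hf.1 continuous_const)
  obtain ⟨δ, hδ, h⟩ := hD.exists_drop hf (A := {x | a ≤ f x ∧ f x ≤ b})
    (isBounded_image_of_le hbdd fun _ h => h.2) (by
      rw [hclosed.closure_eq]
      exact fun x hx hfx => (hab x hfx hx.2).not_ge hx.1)
  obtain ⟨n, hn⟩ := exists_nat_gt ((b - a) / δ)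
  rw [div_lt_iff₀ hδ] at hn
  -- Each step loses δ until level `a` is passed, after which the orbit stays below.
  have key : ∀ k : ℕ, ∀ x, f x ≤ b → f (φ^[k] x) ≤ max a (b - k * δ) := by
    intro k x hx
    induction k with
    | zero => simp [hx]
    | succ k ih =>
      rw [Function.iterate_succ_apply']
      have hle := hf.2 (φ^[k] x)
      by_cases hak : f (φ^[k] x) < a
      · exact (hle.trans hak.le).trans (le_max_left _ _)
      · have hb : f (φ^[k] x) ≤ b := by
          have : ∀ j : ℕ, f (φ^[j] x) ≤ f x := fun j => by
            induction j with
            | zero => rfl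
            | succ j ihj => rw [Function.iterate_succ_apply']; exact (hf.2 _).trans ihj
          exact (this k).trans hx
        have hd := h _ ⟨not_lt.1 hak, hb⟩
        push_cast
        rcases le_max_iff.1 ih with h1 | h1
        · exact le_max_of_le_left (hle.trans h1)
        · exact le_max_of_le_right (by linarith)
  exact ⟨n, fun x hx => (key n x hx).trans (max_le le_rfl (by linarith))⟩

/-- Deformation lemma: outside a neighborhood `U` of the fixed points at an isolated level `c`,
the map `φ` crosses the level `c`. -/
theorem ConditionD.exists_cross (hD : ConditionD φ f) (hf : IsLyapunov φ f)
    (hbdd : BddBelow (Set.range f)) {c b η : ℝ} (hη : 0 < η)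
    (hc : ∀ x ∈ Function.fixedPoints φ, f x ≤ b → |f x - c| ≤ η → f x = c)
    {U : Set Y} (hU : IsOpen U) (hcU : ∀ x ∈ Function.fixedPoints φ, f x = c → x ∈ U) :
    ∃ ε > 0, ∀ x ∉ U, f x ≤ b → f x ≤ c + ε → f (φ x) ≤ c - ε := by
  have hclosed : IsClosed {x | x ∉ U ∧ f x ≤ b ∧ |f x - c| ≤ η} :=
    hU.isClosed_compl.inter ((isClosed_le hf.1 continuous_const).inter
      (isClosed_le ((hf.1.sub continuous_const).abs) continuous_const))
  obtain ⟨δ, hδ, h⟩ := hD.exists_drop hf (A := {x | x ∉ U ∧ f x ≤ b ∧ |f x - c| ≤ η})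
    (isBounded_image_of_le hbdd fun _ h => h.2.1) (by
      rw [hclosed.closure_eq]
      exact fun x hx hfx => hx.1 (hcU x hfx (hc x hfx hx.2.1 hx.2.2)))
  -- A drop of δ takes `c + δ / 2` to `c - δ / 2`; points below `c - η` need no drop.
  refine ⟨min η (δ / 2), by positivity, fun x hxU hxb hxc => ?_⟩
  have h1 := min_le_left η (δ / 2)
  have h2 := min_le_right η (δ / 2)
  by_cases hlow : f x < c - η
  · linarith [hf.2 x]
  · have := h x ⟨hxU, hxb, abs_le.2 ⟨by linarith, by linarith⟩⟩
    linarith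

/-- Lusternik–Schnirelmann theorem for an index function `ν`, with the fixed point levels below
`lam` contained in a finite set `S`. -/
theorem ConditionD.index_sublevel_le_sum (hD : ConditionD φ f) (hf : IsLyapunov φ f)
    (hbdd : BddBelow (Set.range f)) {ν : Set Y → ℕ∞} (hν_empty : ν ∅ = 0)
    (hν_mono : ∀ A B, A ⊆ B → ν A ≤ ν B) (hν_union : ∀ A B, ν (A ∪ B) ≤ ν A + ν B)
    (hν_open : ∀ A, ∃ U, IsOpen U ∧ A ⊆ U ∧ ν U ≤ ν A) (hν_image : ∀ A, ν A ≤ ν (φ '' A))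
    (S : Finset ℝ) (lam : ℝ) (hS : ∀ x ∈ Function.fixedPoints φ, f x ≤ lam → f x ∈ S) :
    ν {x | f x ≤ lam} ≤ ∑ c ∈ S, ν ({x | f x = c} ∩ Function.fixedPoints φ) := by
  classical
  have hν_iterate : ∀ (n : ℕ) (A B : Set Y), (∀ x ∈ A, φ^[n] x ∈ B) → ν A ≤ ν B := by
    intro n
    induction n with
    | zero => exact fun A B h => hν_mono A B h
    | succ n ih => exact fun A B h => (hν_image A).trans (ih _ B (Set.forall_mem_image.2 h))
  induction S using Finset.strongInduction generalizing lam with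
  | H S ih =>
  rcases S.eq_empty_or_nonempty with rfl | hSne
  · obtain ⟨m, hm⟩ := hbdd
    obtain ⟨n, hn⟩ := hD.exists_iterate_le hf ⟨m, hm⟩ (a := m - 1) (b := lam)
      fun x hx hxl => absurd (hS x hx hxl) (Finset.notMem_empty _)
    have : {x | f x ≤ lam} = ∅ := by
      refine Set.eq_empty_of_forall_notMem fun x hx => ?_
      have h1 := hn x hx
      have h2 : m ≤ f (φ^[n] x) := hm ⟨_, rfl⟩
      linarith
    rw [this, hν_empty]
    exact zero_le
  · set c := S.max' hSne
    have hcS : c ∈ S := S.max'_mem hSne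
    have hss := Finset.erase_ssubset hcS
    rw [← Finset.sum_erase_add S _ hcS]
    -- `S` need only contain the levels, so its maximum may exceed `lam`; it is then discarded.
    by_cases hcl : lam < c
    · refine (ih _ hss lam fun x hx hxl => Finset.mem_erase.2 ⟨?_, hS x hx hxl⟩).trans
        le_self_add
      exact (hxl.trans_lt hcl).ne
    rw [not_lt] at hcl
    obtain ⟨η, hη, hball⟩ : ∃ η > 0, Metric.closedBall c η ⊆ ((S.erase c : Finset ℝ) : Set ℝ)ᶜ :=
      Metric.nhds_basis_closedBall.mem_iff.1
        ((S.erase c).finite_toSet.isClosed.isOpen_compl.mem_nhds (by simp))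
    obtain ⟨U, hUo, hKU, hνU⟩ := hν_open ({x | f x = c} ∩ Function.fixedPoints φ)
    obtain ⟨ε, hε, hcross⟩ := hD.exists_cross hf hbdd (c := c) (b := lam) hη
      (fun x hx hxl hxc => by
        by_contra hne
        exact hball (Metric.mem_closedBall.2 hxc)
          (Finset.mem_coe.2 (Finset.mem_erase.2 ⟨hne, hS x hx hxl⟩)))
      hUo (fun x hx hxc => hKU ⟨hxc, hx⟩)
    -- The cap at `lam` matters when `c = lam`: fixed levels just above `lam` are not controlled by
    -- `S`.
    obtain ⟨n, hn⟩ : ∃ n : ℕ, ∀ x, f x ≤ lam → f (φ^[n] x) ≤ min lam (c + ε) := by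
      rcases hcl.eq_or_lt with heq | hlt
      · exact ⟨0, fun x hx => le_min hx (hx.trans (by linarith))⟩
      · exact hD.exists_iterate_le hf hbdd fun x hx hxl =>
          (S.le_max' _ (hS x hx hxl)).trans_lt (lt_min hlt (by linarith))
    calc ν {x | f x ≤ lam}
        ≤ ν {x | f x ≤ min lam (c + ε)} := hν_iterate n _ _ hn
      _ ≤ ν ({x | f x ≤ min lam (c + ε)} \ U ∪ U) :=
          hν_mono _ _ fun x hx => by by_cases h : x ∈ U <;> simp_all
      _ ≤ ν ({x | f x ≤ min lam (c + ε)} \ U) + ν U := hν_union _ _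
      _ ≤ ν {x | f x ≤ c - ε} + ν U := by
          refine add_le_add_left (hν_iterate 1 _ _ fun x hx => ?_) _
          exact hcross x hx.2 (hx.1.trans (min_le_left _ _)) (hx.1.trans (min_le_right _ _))
      _ ≤ _ := by
          refine add_le_add (ih _ hss _ fun x hx hxl => ?_) hνU
          exact Finset.mem_erase.2 ⟨by linarith, hS x hx (by linarith)⟩

end LusternikSchnirelmann

/-! ### Infinite sums in `ℕ∞` and the main theorem -/

theorem sum_le_tsum_enat {ι : Type*} (g : ι → ℕ∞) (s : Finset ι) : ∑ i ∈ s, g i ≤ ∑' i, g i :=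
  Summable.sum_le_tsum s (fun _ _ => zero_le)
    (hasSum_of_isLUB _ (isLUB_iSup (f := fun t : Finset ι => ∑ i ∈ t, g i))).summable

theorem tsum_enat_eq_top {ι : Type*} {g : ι → ℕ∞} (hg : {i | 1 ≤ g i}.Infinite) :
    ∑' i, g i = ⊤ := by
  refine ENat.eq_top_iff_forall_ge.2 fun n => ?_
  obtain ⟨s, hs, rfl⟩ := hg.exists_subset_card_eq n
  refine le_trans ?_ (sum_le_tsum_enat g s)
  simpa using Finset.card_nsmul_le_sum s g 1 fun i hi => hs hi

end ParamTC

theorem theorem5p11 {E : Type u} {X : Type v} [TopologicalSpace E] [TopologicalSpace X]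
    (hE : ParamTC.IsANR E) (hX : ParamTC.IsANR X)
    (p : E → X) (hp : ParamTC.IsFibration p)
    (hfib : ∀ x : X, (p ⁻¹' {x}).Nonempty → IsPathConnected (p ⁻¹' {x}))
    (r : ℕ) (hr : 2 ≤ r)
    (Φ : ParamTC.FiberPower p r × unitInterval → ParamTC.FiberPower p r)
    (hΦ : Continuous Φ)
    (hΦ_zero : ∀ w, Φ (w, 0) = w)
    (hΦ_fiber : ∀ w t, ParamTC.fiberProj p hr (Φ (w, t)) = ParamTC.fiberProj p hr w)
    (F : ParamTC.FiberPower p r → ℝ)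
    (hF : ParamTC.IsLyapunov (fun w => Φ (w, 1)) F)
    (hF_bdd : BddBelow (Set.range F))
    (hD : ParamTC.ConditionD (fun w => Φ (w, 1)) F)
    (lam : ℝ) :
    ParamTC.subspaceTC p hr {w | F w ≤ lam} ≤
      ∑' μ : Set.Iic lam, ParamTC.subspaceTC p hr
        ({w | F w = (μ : ℝ)} ∩ Function.fixedPoints (fun w => Φ (w, 1))) := by
  set φ : ParamTC.FiberPower p r → ParamTC.FiberPower p r := fun w => Φ (w, 1)
  set g : Set.Iic lam → ℕ∞ := fun μ =>
    ParamTC.subspaceTC p hr ({w | F w = (μ : ℝ)} ∩ Function.fixedPoints φ)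
  by_cases hinf : {μ | 1 ≤ g μ}.Infinite
  · exact (ParamTC.tsum_enat_eq_top hinf).symm ▸ le_top
  have hfin : {μ | 1 ≤ g μ}.Finite := Set.not_infinite.1 hinf
  refine le_trans ?_ (ParamTC.sum_le_tsum_enat g hfin.toFinset)
  refine (hD.index_sublevel_le_sum hF hF_bdd (ν := ParamTC.subspaceTC p hr)
    ParamTC.subspaceTC_empty (fun _ _ => ParamTC.subspaceTC_mono) ParamTC.subspaceTC_union_le
    ParamTC.exists_isOpen_subspaceTC_le (ParamTC.subspaceTC_le_image hΦ hΦ_zero hΦ_fiber)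
    (hfin.toFinset.map (Function.Embedding.subtype _)) lam fun x hx hxl => ?_).trans_eq ?_
  · exact Finset.mem_map.2 ⟨⟨F x, hxl⟩,
      hfin.mem_toFinset.2 (ParamTC.one_le_subspaceTC ⟨x, rfl, hx⟩), rfl⟩
  · exact Finset.sum_map _ _ _
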